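/- Let $\mathcal H$ be a finite-dimensional complex Hilbert space and let $\mathcal M$ be a set of density operators (positive semidefinite operators of trace one) on $\mathcal H$. The following are equivalent. (a) There are a finite-dimensional Hilbert space $\mathcal K$ and a completely positive trace preserving linear map $\Lambda$ from the operators on $\mathcal H$ to the operators on $\mathcal K$ that is purifying on $\mathcal M$, i.e. $\operatorname{tr}(\Lambda[\rho]^2)=1$ for all $\rho\in\mathcal M$, and reversible on $\mathcal M$, i.e. there is a completely positive trace preserving linear map $\Lambda'$ from the operators on $\mathcal K$ to the operators on $\mathcal H$ with $\Lambda'[\Lambda[\rho]]=\rho$ for all $\rho\in\mathcal M$. (b) $\mathcal M$ is an orthogonal union of essentially pure sets: $\mathcal M=\bigcup_i\mathcal M_i$, where $\operatorname{tr}(\rho\sigma)=0$ whenever $\rho\in\mathcal M_i$, $\sigma\in\mathcal M_j$ and $i\neq j$, and where for each $i$ there are finite-dimensional Hilbert spaces $\mathcal H_A^i,\mathcal H_B^i,\mathcal H_C^i$, a unitary $U_i\colon\mathcal H_A^i\otimes\mathcal H_B^i\to\mathcal H\otimes\mathcal H_C^i$ and density operators $\sigma_B^i$ on $\mathcal H_B^i$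 and $\omega_C^i$ on $\mathcal H_C^i$ such that $$\{\rho\otimes\omega_C^i\mid\rho\in\mathcal M_i\}\subset\{U_i(|\phi\rangle\langle\phi|\otimes\sigma_B^i)U_i^\dagger\mid|\phi\rangle\in\mathcal H_A^i\}.$$ -/

import Mathlib

open scoped Kronecker ComplexOrder

namespace PurRev

/-- Density operators on the finite-dimensional space with orthonormal basis `n`:
positive semidefinite with trace one. -/
def IsDensity {n : Type*} [Fintype n] (ρ : Matrix n n ℂ) : Prop :=
  ρ.PosSemidef ∧ ρ.trace = 1

/-- The ampliation `Φ ⊗ id_k` of a linear map `Φ : L(H) → L(K)`, applied to an operator on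
`H ⊗ ℂ^k`: the map `Φ` acts on every `H`-block of the operator. -/
def ampliation {n m : Type*} (Φ : Matrix n n ℂ →ₗ[ℂ] Matrix m m ℂ) (k : ℕ)
    (X : Matrix (n × Fin k) (n × Fin k) ℂ) : Matrix (m × Fin k) (m × Fin k) ℂ :=
  Matrix.of fun p q => Φ (Matrix.of fun i j => X (i, p.2) (j, q.2)) p.1 q.1

/-- Completely positive and trace preserving linear maps `L(H) → L(K)`. -/
def IsCPTP {n m : Type*} [Fintype n] [Fintype m]
    (Φ : Matrix n n ℂ →ₗ[ℂ] Matrix m m ℂ) : Prop :=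
  (∀ (k : ℕ) (X : Matrix (n × Fin k) (n × Fin k) ℂ),
    X.PosSemidef → (ampliation Φ k X).PosSemidef) ∧
  ∀ X : Matrix n n ℂ, (Φ X).trace = X.trace

/-- `Φ` is purifying on `M`: every output `Φ ρ`, `ρ ∈ M`, satisfies `tr ((Φ ρ)²) = 1`. -/
def IsPurifyingOn {n m : Type*} [Fintype m]
    (Φ : Matrix n n ℂ →ₗ[ℂ] Matrix m m ℂ) (M : Set (Matrix n n ℂ)) : Prop :=
  ∀ ρ ∈ M, (Φ ρ * Φ ρ).trace = 1

/-- `Φ` is reversible on `M`: some CPTP map undoes the action of `Φ` on all of `M`. -/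
def IsReversibleOn {n m : Type*} [Fintype n] [Fintype m]
    (Φ : Matrix n n ℂ →ₗ[ℂ] Matrix m m ℂ) (M : Set (Matrix n n ℂ)) : Prop :=
  ∃ Φ' : Matrix m m ℂ →ₗ[ℂ] Matrix n n ℂ, IsCPTP Φ' ∧ ∀ ρ ∈ M, Φ' (Φ ρ) = ρ

/-- Orthogonality of two sets of states. -/
def Orthogonal {n : Type*} [Fintype n] (M N : Set (Matrix n n ℂ)) : Prop :=
  ∀ ρ ∈ M, ∀ σ ∈ N, (ρ * σ).trace = 0

/-- Essentially pure sets: for suitable finite-dimensional spaces `H_C = ℂ^c`, `H_A = ℂ^a`,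
`H_B = ℂ^b`, a unitary `U : H_A ⊗ H_B → H ⊗ H_C` and density operators `ω` on `H_C` and `σ` on
`H_B`, every `ρ ⊗ ω` with `ρ ∈ M` is of the form `U (|φ⟩⟨φ| ⊗ σ) U†` with `φ ∈ H_A`.
(`φ` is then a unit vector whenever `ρ` is a state, by taking traces.) -/
def IsEssentiallyPure {n : Type*} [Fintype n] [DecidableEq n]
    (M : Set (Matrix n n ℂ)) : Prop :=
  ∃ (c a b : ℕ) (ω : Matrix (Fin c) (Fin c) ℂ) (σ : Matrix (Fin b) (Fin b) ℂ)
    (U : Matrix (n × Fin c) (Fin a × Fin b) ℂ),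
    IsDensity ω ∧ IsDensity σ ∧ U * U.conjTranspose = 1 ∧ U.conjTranspose * U = 1 ∧
    (fun ρ : Matrix n n ℂ => ρ ⊗ₖ ω) '' M ⊆
      Set.range fun φ : Fin a → ℂ =>
        U * (Matrix.vecMulVec φ (star φ) ⊗ₖ σ) * U.conjTranspose

end PurRev

namespace PurRev

open Matrix

/-! Sufficiency of (b). On one essentially pure set, adjoining `ω`, applying U† and discarding H_B
outputs |φ⟩⟨φ|; adjoining `σ`, applying U and discarding H_C undoes this. States of zero overlap
have orthogonal supports, so the support projections tell the sets apart without disturbance and the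
channels combine as a direct sum (`isPurifiable_iUnion`).

Necessity of (b). Let S_i and R_j be Kraus operators of Λ and Λ'. Since Λ ∘ Λ' fixes each pure
output |ψ⟩⟨ψ|, every S_i R_j ψ is a multiple of ψ (`eq_smul_of_sum_vecMulVec_eq`), and M splits
according to the tuple c of eigenvalues. Trace preservation makes unit eigenvectors with different
tuples orthogonal (`dotProduct_eq_zero_of_joint_eigenvectors`). If Q is an isometry onto a joint
eigenspace, then (R_j Q)†(R_k Q) = (∑ᵢ c̄_ij c_ik) 1, the Knill–Laflamme condition. Diagonalising
this Gram matrix turns the R_j Q into multiples of isometries with orthogonal ranges, which together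
extend to the unitary U. -/

/-- Complete positivity of a linear map between matrix algebras. -/
def IsCP {n m : Type*} [Fintype n] [Fintype m] (Φ : Matrix n n ℂ →ₗ[ℂ] Matrix m m ℂ) : Prop :=
  ∀ (k : ℕ) (X : Matrix (n × Fin k) (n × Fin k) ℂ),
    X.PosSemidef → (ampliation Φ k X).PosSemidef

/-! ### Building blocks of channels: conjugation, ancillas, partial trace -/

section CompletelyPositive

variable {n m l : Type*} [Fintype n] [Fintype m] [Fintype l]

theorem IsCP.comp {Ψ : Matrix m m ℂ →ₗ[ℂ] Matrix l l ℂ} {Φ : Matrix n n ℂ →ₗ[ℂ] Matrix m m ℂ}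
    (hΨ : IsCP Ψ) (hΦ : IsCP Φ) : IsCP (Ψ ∘ₗ Φ) :=
  fun k X hX => hΨ k _ (hΦ k X hX)

theorem IsCP.sum {ι : Type*} (s : Finset ι) {Φ : ι → Matrix n n ℂ →ₗ[ℂ] Matrix m m ℂ}
    (h : ∀ i ∈ s, IsCP (Φ i)) : IsCP (∑ i ∈ s, Φ i) := by
  intro k X hX
  have : ampliation (∑ i ∈ s, Φ i) k X = ∑ i ∈ s, ampliation (Φ i) k X := by
    ext p q
    simp [ampliation, LinearMap.sum_apply, Matrix.sum_apply]
  rw [this]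
  exact posSemidef_sum s fun i hi => h i hi k X hX

/-- Conjugation `X ↦ V X V†`. -/
def conj (V : Matrix m n ℂ) : Matrix n n ℂ →ₗ[ℂ] Matrix m m ℂ where
  toFun X := V * X * Vᴴ
  map_add' _ _ := by rw [Matrix.mul_add, Matrix.add_mul]
  map_smul' _ _ := by simp

omit [Fintype m] in
@[simp] theorem conj_apply (V : Matrix m n ℂ) (X : Matrix n n ℂ) : conj V X = V * X * Vᴴ := rfl

theorem isCP_conj (V : Matrix m n ℂ) : IsCP (conj V) := by
  intro k X hX
  have : ampliation (conj V) k X =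
      (V ⊗ₖ (1 : Matrix (Fin k) (Fin k) ℂ)) * X * (V ⊗ₖ (1 : Matrix (Fin k) (Fin k) ℂ))ᴴ := by
    ext ⟨p, a⟩ ⟨q, b⟩
    simp [ampliation, Matrix.mul_apply, Fintype.sum_prod_type, Matrix.one_apply, apply_ite,
      Finset.sum_ite_eq, ite_mul]
  rw [this]
  exact hX.mul_mul_conjTranspose_same _

theorem trace_conj {V : Matrix m n ℂ} [DecidableEq n] (hV : Vᴴ * V = 1) (X : Matrix n n ℂ) :
    (conj V X).trace = X.trace := by
  rw [conj_apply, Matrix.trace_mul_cycle, hV, Matrix.one_mul]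

/-- Adjoining an ancilla in the state `ω`. -/
def adjoin (n : Type*) (ω : Matrix m m ℂ) : Matrix n n ℂ →ₗ[ℂ] Matrix (n × m) (n × m) ℂ where
  toFun X := X ⊗ₖ ω
  map_add' _ _ := Matrix.add_kronecker _ _ _
  map_smul' _ _ := Matrix.smul_kronecker _ _ _

omit [Fintype n] [Fintype m] in
@[simp] theorem adjoin_apply (ω : Matrix m m ℂ) (X : Matrix n n ℂ) : adjoin n ω X = X ⊗ₖ ω := rfl

theorem isCP_adjoin {ω : Matrix m m ℂ} (hω : ω.PosSemidef) : IsCP (adjoin n ω) := by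
  classical
  intro k X hX
  have : ampliation (adjoin n ω) k X =
      (X ⊗ₖ ω).submatrix (fun p => ((p.1.1, p.2), p.1.2)) (fun p => ((p.1.1, p.2), p.1.2)) := by
    ext ⟨p, a⟩ ⟨q, b⟩
    simp [ampliation]
  rw [this]
  exact (hX.kronecker hω).submatrix _

/-- The partial trace over the second tensor factor. -/
def partialTrace (n m : Type*) [Fintype m] : Matrix (n × m) (n × m) ℂ →ₗ[ℂ] Matrix n n ℂ where
  toFun X := Matrix.of fun i j => ∑ b, X (i, b) (j, b)
  map_add' _ _ := by ext; simp [Finset.sum_add_distrib]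
  map_smul' _ _ := by ext; simp [Finset.mul_sum]

omit [Fintype n] in
theorem partialTrace_apply (X : Matrix (n × m) (n × m) ℂ) (i j : n) :
    partialTrace n m X i j = ∑ b, X (i, b) (j, b) := rfl

theorem isCP_partialTrace : IsCP (partialTrace n m) := by
  intro k X hX
  have : ampliation (partialTrace n m) k X =
      ∑ b, X.submatrix (fun p => ((p.1, b), p.2)) (fun p => ((p.1, b), p.2)) := by
    ext ⟨p, a⟩ ⟨q, b⟩
    simp [ampliation, partialTrace_apply, Matrix.sum_apply]
  rw [this]
  exact posSemidef_sum _ fun i _ => hX.submatrix _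

theorem trace_partialTrace (X : Matrix (n × m) (n × m) ℂ) :
    (partialTrace n m X).trace = X.trace := by
  simp [Matrix.trace, partialTrace_apply, Fintype.sum_prod_type]

omit [Fintype n] in
theorem partialTrace_kronecker (X : Matrix n n ℂ) (ω : Matrix m m ℂ) :
    partialTrace n m (X ⊗ₖ ω) = ω.trace • X := by
  ext i j
  simp [partialTrace_apply, Matrix.trace, ← Finset.mul_sum, mul_comm]

end CompletelyPositive

/-! ### Spectral decomposition and pure states -/

section Spectral

variable {n : Type*} [Fintype n] [DecidableEq n]

theorem exists_unitary_diagonal {A : Matrix n n ℂ} (hA : A.PosSemidef) :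
    ∃ (W : Matrix n n ℂ) (d : n → ℝ), (∀ i, 0 ≤ d i) ∧ Wᴴ * W = 1 ∧ W * Wᴴ = 1 ∧
      A = W * diagonal (fun i => (d i : ℂ)) * Wᴴ := by
  refine ⟨hA.1.eigenvectorUnitary, hA.1.eigenvalues, hA.eigenvalues_nonneg, ?_, ?_, ?_⟩
  · exact Unitary.coe_star_mul_self hA.1.eigenvectorUnitary
  · exact Unitary.coe_mul_star_self hA.1.eigenvectorUnitary
  · conv_lhs => rw [hA.1.spectral_theorem]
    rfl

theorem exists_eq_conjTranspose_mul_self {A : Matrix n n ℂ} (hA : A.PosSemidef) :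
    ∃ B : Matrix n n ℂ, A = Bᴴ * B := by
  obtain ⟨W, d, hd, -, -, h⟩ := exists_unitary_diagonal hA
  refine ⟨diagonal (fun i => (Real.sqrt (d i) : ℂ)) * Wᴴ, ?_⟩
  rw [conjTranspose_mul, conjTranspose_conjTranspose, Matrix.mul_assoc, ← Matrix.mul_assoc _ _ Wᴴ,
    diagonal_conjTranspose, diagonal_mul_diagonal, ← Matrix.mul_assoc, h]
  congr! with i
  simp [← Complex.ofReal_mul, Real.mul_self_sqrt (hd i)]

theorem conj_vecMulVec {m n : Type*} [Fintype n] (K : Matrix m n ℂ) (ψ : n → ℂ) :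
    K * vecMulVec ψ (star ψ) * Kᴴ = vecMulVec (K *ᵥ ψ) (star (K *ᵥ ψ)) := by
  rw [Matrix.mul_vecMulVec, Matrix.vecMulVec_mul, star_mulVec]

/-- A state of purity one is a rank-one projection. -/
theorem exists_eq_vecMulVec {A : Matrix n n ℂ} (hA : A.PosSemidef) (htr : A.trace = 1)
    (hsq : (A * A).trace = 1) :
    ∃ ψ : n → ℂ, star ψ ⬝ᵥ ψ = 1 ∧ A = vecMulVec ψ (star ψ) := by
  obtain ⟨W, d, hd, hW, -, h⟩ := exists_unitary_diagonal hA
  have h1 : ∑ i, d i = 1 := by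
    rw [h, trace_mul_cycle, hW, Matrix.one_mul, trace_diagonal] at htr
    exact_mod_cast htr
  have h2 : ∑ i, d i * d i = 1 := by
    have : A * A = W * (diagonal (fun i => (d i : ℂ)) * diagonal (fun i => (d i : ℂ))) * Wᴴ := by
      rw [h]
      simp only [Matrix.mul_assoc]
      rw [← Matrix.mul_assoc Wᴴ, hW, Matrix.one_mul]
    rw [this, diagonal_mul_diagonal, trace_mul_cycle, hW, Matrix.one_mul, trace_diagonal] at hsq
    exact_mod_cast hsq
  have hle : ∀ i, d i ≤ 1 := fun i => by
    rw [← h1]; exact Finset.single_le_sum (fun j _ => hd j) (Finset.mem_univ i)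
  -- Trace and purity both one force every eigenvalue to be 0 or 1.
  have h3 : ∑ i, d i * (1 - d i) = 0 := by
    simp only [mul_sub, mul_one, Finset.sum_sub_distrib, h1, h2, sub_self]
  have h4 : ∀ i, d i * (1 - d i) = 0 := fun i =>
    (Finset.sum_eq_zero_iff_of_nonneg
      (fun j _ => mul_nonneg (hd j) (sub_nonneg.2 (hle j)))).1 h3 i (Finset.mem_univ i)
  obtain ⟨i, hi⟩ : ∃ i, d i ≠ 0 := by
    by_contra! hall
    simp [hall] at h1
  have hi1 : d i = 1 := by
    rcases mul_eq_zero.1 (h4 i) with h | h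
    · exact absurd h hi
    · linarith
  have hother : ∀ j, j ≠ i → d j = 0 := by
    intro j hj
    rw [← Finset.add_sum_erase _ _ (Finset.mem_univ i), hi1] at h1
    exact (Finset.sum_eq_zero_iff_of_nonneg (fun j _ => hd j)).1 (by linarith) j
      (Finset.mem_erase.2 ⟨hj, Finset.mem_univ j⟩)
  have hdiag : diagonal (fun i => (d i : ℂ)) =
      vecMulVec (Pi.single i 1) (star (Pi.single i (1 : ℂ))) := by
    ext j k
    rcases eq_or_ne j k with rfl | hjk
    · rcases eq_or_ne j i with rfl | hj
      · simp [vecMulVec_apply, hi1]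
      · simp [vecMulVec_apply, hother j hj, hj]
    · rcases eq_or_ne j i with rfl | hj
      · simp [vecMulVec_apply, hjk, hjk.symm]
      · simp [vecMulVec_apply, hjk, hj]
  have hA' : A = vecMulVec (W *ᵥ Pi.single i 1) (star (W *ᵥ Pi.single i 1)) := by
    rw [h, hdiag, conj_vecMulVec]
  refine ⟨_, ?_, hA'⟩
  rw [hA', trace_vecMulVec, dotProduct_comm] at htr
  exact htr

end Spectral

/-! ### Kraus representations -/

section Kraus

/-- Completely positive maps have a Kraus representation. -/
theorem IsCP.exists_kraus {n m : Type*} [Fintype n] [DecidableEq n] [Fintype m]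
    {Φ : Matrix n n ℂ →ₗ[ℂ] Matrix m m ℂ} (hΦ : IsCP Φ) :
    ∃ (N : ℕ) (K : Fin N → Matrix m n ℂ), ∀ X, Φ X = ∑ l, K l * X * (K l)ᴴ := by
  classical
  let e := Fintype.equivFin n
  -- The unnormalised maximally entangled vector: the ampliation of its projection is the Choi
  -- matrix. The rows of a factor `B` of that matrix, conjugated and reshaped, are the Kraus
  -- operators.
  let Ω : n × Fin (Fintype.card n) → ℂ := fun p => if e p.1 = p.2 then 1 else 0
  obtain ⟨B, hB⟩ := exists_eq_conjTranspose_mul_self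
    (hΦ _ (vecMulVec Ω (star Ω)) (posSemidef_vecMulVec_self_star Ω))
  let f := Fintype.equivFin (m × Fin (Fintype.card n))
  let K : Fin (Fintype.card (m × Fin (Fintype.card n))) → Matrix m n ℂ :=
    fun l => Matrix.of fun p i => star (B (f.symm l) (p, e i))
  refine ⟨_, K, fun X => ?_⟩
  suffices h : Φ = ∑ l, conj (K l) by
    rw [h]; simp [LinearMap.sum_apply]
  refine Matrix.ext_linearMap _ fun i j => ?_
  ext1
  ext p q
  have := congrFun (congrFun hB (p, e i)) (q, e j)
  have hE : (Matrix.of fun i' j' => vecMulVec Ω (star Ω) (i', e i) (j', e j)) =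
      Matrix.single i j 1 := by
    ext i' j'
    simp only [of_apply, vecMulVec_apply, Ω, Pi.star_apply, EmbeddingLike.apply_eq_iff_eq,
      Matrix.single_apply]
    by_cases h1 : i' = i <;> by_cases h2 : j' = j <;> 
      simp [h1, h2, eq_comm (a := i) (b := i'), eq_comm (a := j) (b := j')]
  simp only [ampliation, of_apply, hE, Matrix.mul_apply] at this
  rw [LinearMap.comp_apply, LinearMap.comp_apply, Matrix.singleLinearMap_apply, this,
    LinearMap.sum_apply, Matrix.sum_apply, ← f.symm.sum_comp]
  refine Finset.sum_congr rfl fun l _ => ?_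
  rw [conj_apply, Matrix.mul_assoc, Matrix.mul_apply]
  simp [K, Matrix.single_apply, Matrix.mul_apply, ite_and]

/-- The Kraus operators of a trace preserving map resolve the identity. -/
theorem sum_conjTranspose_mul_self_eq_one {n m κ : Type*} [Fintype n] [DecidableEq n] [Fintype m]
    [Fintype κ] {Φ : Matrix n n ℂ →ₗ[ℂ] Matrix m m ℂ} {K : κ → Matrix m n ℂ}
    (hK : ∀ X, Φ X = ∑ l, K l * X * (K l)ᴴ) (hΦ : ∀ X, (Φ X).trace = X.trace) :
    ∑ l, (K l)ᴴ * K l = 1 := by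
  rw [Matrix.ext_iff_trace_mul_right]
  intro X
  rw [Matrix.one_mul, ← hΦ X, hK X, Matrix.sum_mul, Matrix.trace_sum, Matrix.trace_sum]
  exact Finset.sum_congr rfl fun l _ => (Matrix.trace_mul_cycle _ _ _).symm

end Kraus

/-! ### From orthogonal unions to purifying reversible channels -/

section Sufficiency

variable {n : Type*} [Fintype n] [DecidableEq n]

/-- Some channel is purifying and reversible on `M`. -/
def IsPurifiable (M : Set (Matrix n n ℂ)) : Prop :=
  ∃ (m : ℕ) (Φ : Matrix n n ℂ →ₗ[ℂ] Matrix (Fin m) (Fin m) ℂ),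
    IsCPTP Φ ∧ IsPurifyingOn Φ M ∧ IsReversibleOn Φ M

-- With ρ = B†B and σ = C†C, the trace is the squared Hilbert–Schmidt norm of BC†.
omit [DecidableEq n] in
theorem mul_eq_zero_of_trace_mul_eq_zero {ρ σ : Matrix n n ℂ} (hρ : ρ.PosSemidef)
    (hσ : σ.PosSemidef) (h : (ρ * σ).trace = 0) : ρ * σ = 0 := by
  classical
  obtain ⟨B, rfl⟩ := exists_eq_conjTranspose_mul_self hρ
  obtain ⟨C, rfl⟩ := exists_eq_conjTranspose_mul_self hσ
  have h0 : B * Cᴴ = 0 := by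
    rw [← trace_conjTranspose_mul_self_eq_zero_iff, conjTranspose_mul, conjTranspose_conjTranspose,
      ← h, Matrix.mul_assoc, Matrix.trace_mul_comm]
    simp only [Matrix.mul_assoc]
  calc Bᴴ * B * (Cᴴ * C) = Bᴴ * (B * Cᴴ) * C := by simp only [Matrix.mul_assoc]
    _ = 0 := by rw [h0]; simp

/-- The projection onto the joint support of a set of Hermitian matrices. -/
theorem exists_support_projection (S : Set (Matrix n n ℂ)) (hS : ∀ ρ ∈ S, ρ.IsHermitian) :
    ∃ P : Matrix n n ℂ, Pᴴ = P ∧ P * P = P ∧ (∀ ρ ∈ S, P * ρ = ρ) ∧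
      ∀ X : Matrix n n ℂ, (∀ ρ ∈ S, ρ * X = 0) → P * X = 0 := by
  let T := toEuclideanCLM (n := n) (𝕜 := ℂ)
  let V : Submodule ℂ (EuclideanSpace ℂ n) :=
    Submodule.span ℂ {x | ∃ ρ ∈ S, ∃ y, x = T ρ y}
  obtain ⟨P, hP⟩ := EquivLike.surjective T V.starProjection
  have hinj : Function.Injective T := EquivLike.injective T
  refine ⟨P, hinj ?_, hinj ?_, fun ρ hρ => hinj ?_, fun X hX => hinj ?_⟩
  · rw [← star_eq_conjTranspose, map_star, hP, (isSelfAdjoint_starProjection V).star_eq]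
  · rw [map_mul, hP, (V.isIdempotentElem_starProjection).eq]
  · rw [map_mul, hP]
    ext1 y
    exact Submodule.starProjection_eq_self_iff.2 (Submodule.subset_span ⟨ρ, hρ, y, rfl⟩)
  · rw [map_mul, hP, map_zero]
    ext1 y
    -- The range of `X` lies in the kernel of each Hermitian ρ, hence is orthogonal to the range of
    -- ρ.
    refine (Submodule.starProjection_apply_eq_zero_iff V).2 ?_
    rw [Submodule.mem_orthogonal]
    intro u hu
    induction hu using Submodule.span_induction with
    | mem x hx =>
      obtain ⟨ρ, hρ, z, rfl⟩ := hx
      have hst : star (T ρ) = T ρ := by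
        rw [← map_star, star_eq_conjTranspose, (hS ρ hρ).eq]
      have hz : (T ρ * T X) y = 0 := by
        rw [← map_mul, hX ρ hρ, map_zero]
        rfl
      rw [← hst, ContinuousLinearMap.star_eq_adjoint, ContinuousLinearMap.adjoint_inner_left]
      exact (congrArg (inner ℂ z) hz).trans (inner_zero_right _)
    | zero => simp
    | add x z _ _ hx hz => rw [inner_add_left, hx, hz, add_zero]
    | smul c x _ hx => rw [inner_smul_left, hx, mul_zero]

theorem isPurifiable_of_isEssentiallyPure {M : Set (Matrix n n ℂ)} (hM : ∀ ρ ∈ M, IsDensity ρ)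
    (h : IsEssentiallyPure M) : IsPurifiable M := by
  obtain ⟨c, a, b, ω, σ, U, hω, hσ, hU, hU', hsub⟩ := h
  let Λ := partialTrace (Fin a) (Fin b) ∘ₗ conj Uᴴ ∘ₗ adjoin n ω
  let Λ' := partialTrace n (Fin c) ∘ₗ conj U ∘ₗ adjoin (Fin a) σ
  have htr : ∀ X, (Λ X).trace = X.trace := fun X => by
    simp only [Λ, LinearMap.comp_apply]
    rw [trace_partialTrace, trace_conj (by rwa [conjTranspose_conjTranspose]), adjoin_apply,
      trace_kronecker, hω.2, mul_one]
  have key : ∀ ρ ∈ M, ∃ φ : Fin a → ℂ, Λ ρ = vecMulVec φ (star φ) ∧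
      ρ ⊗ₖ ω = U * (vecMulVec φ (star φ) ⊗ₖ σ) * Uᴴ := by
    intro ρ hρ
    obtain ⟨φ, hφ⟩ := hsub ⟨ρ, hρ, rfl⟩
    have hφ' : ρ ⊗ₖ ω = U * (vecMulVec φ (star φ) ⊗ₖ σ) * Uᴴ := hφ.symm
    refine ⟨φ, ?_, hφ'⟩
    simp only [Λ, LinearMap.comp_apply, adjoin_apply, conj_apply, conjTranspose_conjTranspose]
    rw [hφ', show Uᴴ * (U * (vecMulVec φ (star φ) ⊗ₖ σ) * Uᴴ) * U =
      (Uᴴ * U) * (vecMulVec φ (star φ) ⊗ₖ σ) * (Uᴴ * U) by simp only [Matrix.mul_assoc], hU',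
      Matrix.one_mul, Matrix.mul_one, partialTrace_kronecker, hσ.2, one_smul]
  refine ⟨a, Λ, ⟨isCP_partialTrace.comp ((isCP_conj _).comp (isCP_adjoin hω.1)), htr⟩, ?_, Λ',
    ⟨isCP_partialTrace.comp ((isCP_conj _).comp (isCP_adjoin hσ.1)), ?_⟩, ?_⟩
  · intro ρ hρ
    obtain ⟨φ, hφ, -⟩ := key ρ hρ
    have h1 := htr ρ
    rw [(hM ρ hρ).2, hφ, trace_vecMulVec, dotProduct_comm] at h1
    rw [hφ, vecMulVec_mul_vecMulVec, h1, one_smul, trace_vecMulVec, dotProduct_comm, h1]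
  · intro X
    simp only [Λ', LinearMap.comp_apply]
    rw [trace_partialTrace, trace_conj hU', adjoin_apply, trace_kronecker, hσ.2, mul_one]
  · intro ρ hρ
    obtain ⟨φ, hφ, h2⟩ := key ρ hρ
    rw [hφ]
    simp only [Λ', LinearMap.comp_apply, adjoin_apply, conj_apply]
    rw [← h2, partialTrace_kronecker, hω.2, one_smul]

/-- Supplies a channel for the complement of all supports, where no state lives; any invertible
relabelling will do. -/
theorem isPurifiable_empty : IsPurifiable (∅ : Set (Matrix n n ℂ)) := by
  let e := Fintype.equivFin n
  let V : Matrix (Fin (Fintype.card n)) n ℂ := (1 : Matrix n n ℂ).submatrix e.symm id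
  have h1 : Vᴴ * V = 1 := by
    rw [conjTranspose_submatrix, conjTranspose_one, submatrix_mul_equiv]
    simp
  have h2 : V * Vᴴ = 1 := (mul_eq_one_comm_of_equiv e).1 h1
  exact ⟨_, conj V, ⟨isCP_conj V, trace_conj h1⟩, by simp [IsPurifyingOn], conj Vᴴ,
    ⟨isCP_conj _, trace_conj (by rwa [conjTranspose_conjTranspose])⟩, by simp⟩

/-- Purifiable sets supported on orthogonal subspaces have a purifiable union. -/
theorem isPurifiable_iUnion {J : Type*} [Fintype J] [DecidableEq J] (P : J → Matrix n n ℂ)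
    (hP : ∀ j, (P j)ᴴ = P j) (hsum : ∑ j, P j * P j = 1) (N : J → Set (Matrix n n ℂ))
    (hself : ∀ j, ∀ ρ ∈ N j, P j * ρ * P j = ρ)
    (hother : ∀ j k, k ≠ j → ∀ ρ ∈ N j, P k * ρ = 0)
    (hN : ∀ j, IsPurifiable (N j)) : IsPurifiable (⋃ j, N j) := by
  choose a Λ hΛ hpur Λ' hΛ' hrev using hN
  let e := Fintype.equivFin (Σ j, Fin (a j))
  -- Isometric inclusion of the j-th output space into the direct sum.
  let V : (j : J) → Matrix (Fin (Fintype.card (Σ j, Fin (a j)))) (Fin (a j)) ℂ :=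
    fun j => Matrix.of fun p x => if e ⟨j, x⟩ = p then 1 else 0
  have hV1 : ∀ j, (V j)ᴴ * V j = 1 := fun j => by
    ext x y
    simp [V, Matrix.mul_apply, Matrix.one_apply, eq_comm]
  have hV2 : ∀ j k, k ≠ j → (V k)ᴴ * V j = 0 := fun j k hjk => by
    ext x y
    simp only [V, Matrix.mul_apply, conjTranspose_apply, of_apply, Matrix.zero_apply]
    refine Finset.sum_eq_zero fun p _ => ?_
    by_cases h : e ⟨k, x⟩ = p
    · rw [if_neg (c := e ⟨j, y⟩ = p), mul_zero]
      rintro rfl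
      exact hjk (congrArg Sigma.fst (e.injective h))
    · rw [if_neg h, star_zero, zero_mul]
  have hV3 : ∑ j, V j * (V j)ᴴ = 1 := by
    ext p q
    simp only [V, Matrix.sum_apply, Matrix.mul_apply, of_apply, conjTranspose_apply]
    rw [← Fintype.sum_sigma' (fun j x => (if e ⟨j, x⟩ = p then (1 : ℂ) else 0) *
      star (if e ⟨j, x⟩ = q then (1 : ℂ) else 0)), ← e.symm.sum_comp]
    simp [Matrix.one_apply, eq_comm]
  -- Project with `P j`, apply the j-th channel and store the result in block j; a state of `N j`
  -- survives only in branch j.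
  let Φ : Matrix n n ℂ →ₗ[ℂ] _ := ∑ j, conj (V j) ∘ₗ Λ j ∘ₗ conj (P j)
  let Φ' : _ →ₗ[ℂ] Matrix n n ℂ := ∑ j, Λ' j ∘ₗ conj (V j)ᴴ
  have hΦ : ∀ j, ∀ ρ ∈ N j, Φ ρ = V j * Λ j ρ * (V j)ᴴ := by
    intro j ρ hρ
    simp only [Φ, LinearMap.sum_apply, LinearMap.comp_apply]
    rw [Finset.sum_eq_single j]
    · rw [conj_apply, conj_apply, hP, hself j ρ hρ]
    · intro k _ hk
      simp [hother j k hk ρ hρ]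
    · simp
  refine ⟨_, Φ, ⟨IsCP.sum _ fun j _ => (isCP_conj _).comp (IsCP.comp (hΛ j).1 (isCP_conj _)), ?_⟩,
    ?_, Φ', ⟨IsCP.sum _ fun j _ => IsCP.comp (hΛ' j).1 (isCP_conj _), ?_⟩, ?_⟩
  · intro X
    simp only [Φ, LinearMap.sum_apply, LinearMap.comp_apply, trace_sum]
    simp_rw [trace_conj (hV1 _), (hΛ _).2, conj_apply, hP,
      fun j => Matrix.trace_mul_cycle (P j) X (P j)]
    rw [← trace_sum, ← Matrix.sum_mul, hsum, Matrix.one_mul]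
  · intro ρ hρ
    obtain ⟨j, hj⟩ := Set.mem_iUnion.1 hρ
    rw [hΦ j ρ hj, show V j * Λ j ρ * (V j)ᴴ * (V j * Λ j ρ * (V j)ᴴ) =
      V j * (Λ j ρ * ((V j)ᴴ * V j) * Λ j ρ) * (V j)ᴴ by simp only [Matrix.mul_assoc], hV1,
      Matrix.mul_one, Matrix.trace_mul_cycle, hV1, Matrix.one_mul]
    exact hpur j ρ hj
  · intro X
    simp only [Φ', LinearMap.sum_apply, LinearMap.comp_apply, trace_sum]
    simp_rw [(hΛ' _).2, conj_apply, conjTranspose_conjTranspose,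
      fun j => Matrix.trace_mul_cycle (V j)ᴴ X (V j)]
    rw [← trace_sum, ← Matrix.sum_mul, hV3, Matrix.one_mul]
  · intro ρ hρ
    obtain ⟨j, hj⟩ := Set.mem_iUnion.1 hρ
    rw [hΦ j ρ hj]
    simp only [Φ', LinearMap.sum_apply, LinearMap.comp_apply, conj_apply,
      conjTranspose_conjTranspose]
    rw [Finset.sum_eq_single j]
    · rw [show (V j)ᴴ * (V j * Λ j ρ * (V j)ᴴ) * V j = ((V j)ᴴ * V j) * Λ j ρ * ((V j)ᴴ * V j) by
        simp only [Matrix.mul_assoc], hV1, Matrix.one_mul, Matrix.mul_one, hrev j ρ hj]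
    · intro k _ hk
      rw [show (V k)ᴴ * (V j * Λ j ρ * (V j)ᴴ) * V k = ((V k)ᴴ * V j) * Λ j ρ * ((V j)ᴴ * V k) by
        simp only [Matrix.mul_assoc], hV2 j k hk, Matrix.zero_mul, Matrix.zero_mul, map_zero]
    · simp

-- Nonzero, mutually orthogonal idempotents are linearly independent. This reduces an arbitrary
-- index type to finitely many blocks.
omit [DecidableEq n] in
theorem finite_ne_zero_of_orthogonal_projections {ι : Type*} (P : ι → Matrix n n ℂ)
    (hid : ∀ i, P i * P i = P i) (horth : ∀ i j, i ≠ j → P i * P j = 0) :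
    {i | P i ≠ 0}.Finite := by
  have hli : LinearIndependent ℂ (fun i : {i | P i ≠ 0} => P i) := by
    rw [linearIndependent_iff']
    intro s g hg i hi
    have h1 : P i * ∑ j ∈ s, g j • P j = g i • P i := by
      rw [Matrix.mul_sum, Finset.sum_eq_single i]
      · rw [Matrix.mul_smul, hid]
      · intro j _ hj
        rw [Matrix.mul_smul, horth i j (fun h => hj (Subtype.ext h.symm)), smul_zero]
      · exact fun h => absurd hi h
    rw [hg, Matrix.mul_zero] at h1
    exact (smul_eq_zero.1 h1.symm).resolve_right i.2
  exact Set.finite_coe_iff.1 hli.finite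

theorem isPurifiable_of_orthogonal_union {M : Set (Matrix n n ℂ)} (hM : ∀ ρ ∈ M, IsDensity ρ)
    {ι : Type*} (N : ι → Set (Matrix n n ℂ)) (hMN : M = ⋃ i, N i)
    (horth : ∀ i j, i ≠ j → Orthogonal (N i) (N j)) (hN : ∀ i, IsEssentiallyPure (N i)) :
    IsPurifiable M := by
  classical
  have hd : ∀ i, ∀ ρ ∈ N i, IsDensity ρ := fun i ρ hρ => hM ρ (hMN ▸ Set.mem_iUnion.2 ⟨i, hρ⟩)
  choose P hP hid hself hann using fun i => exists_support_projection (N i)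
    (fun ρ hρ => (hd i ρ hρ).1.1)
  have hzero : ∀ i j, i ≠ j → ∀ ρ ∈ N j, P i * ρ = 0 := fun i j hij ρ hρ =>
    hann i ρ fun σ hσ => mul_eq_zero_of_trace_mul_eq_zero (hd i σ hσ).1 (hd j ρ hρ).1
      (horth i j hij σ hσ ρ hρ)
  have hPP : ∀ i j, i ≠ j → P i * P j = 0 := fun i j hij => hann i _ fun ρ hρ => by
    have := congrArg conjTranspose (hzero j i hij.symm ρ hρ)
    rwa [conjTranspose_mul, hP, (hd i ρ hρ).1.1.eq, conjTranspose_zero] at this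
  have hfin := finite_ne_zero_of_orthogonal_projections P hid hPP
  let J := {i // P i ≠ 0}
  have : Fintype J := hfin.fintype
  let S := ∑ i : J, P i
  have hS : Sᴴ = S := by simp only [S, conjTranspose_sum, hP]
  have hSP : ∀ i : J, P i * S = P i := fun i => by
    rw [Matrix.mul_sum, Finset.sum_eq_single i]
    · exact hid i
    · exact fun j _ hj => hPP i j fun h => hj (Subtype.ext h.symm)
    · simp
  have hSS : S * S = S := by
    conv_lhs => rw [show S = ∑ i : J, P i from rfl, Matrix.sum_mul]
    exact Finset.sum_congr rfl fun i _ => hSP i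
  -- The block `none` carries the complement 1 - S and the empty set, so that the projections sum to
  -- the identity.
  let P' : Option J → Matrix n n ℂ := fun o => o.elim (1 - S) (fun i => P i)
  let N' : Option J → Set (Matrix n n ℂ) := fun o => o.elim ∅ (fun i => N i)
  have hunion : M = ⋃ o, N' o := by
    rw [hMN]
    ext ρ
    simp only [Set.mem_iUnion]
    constructor
    · rintro ⟨i, hi⟩
      -- An index with `P i = 0` contributes no state, since a state has trace one.
      refine ⟨some ⟨i, fun h0 => ?_⟩, hi⟩
      have h1 := hself i ρ hi
      rw [h0, Matrix.zero_mul] at h1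
      have h2 := (hd i ρ hi).2
      rw [← h1] at h2
      simp at h2
    · rintro ⟨_ | i, hi⟩
      · exact hi.elim
      · exact ⟨i, hi⟩
  rw [hunion]
  refine isPurifiable_iUnion P' ?_ ?_ N' ?_ ?_ ?_
  · rintro (_ | i)
    · simp [P', hS]
    · exact hP i
  · rw [Fintype.sum_option]
    simp only [P', Option.elim, hid]
    change (1 - S) * (1 - S) + S = 1
    rw [Matrix.mul_sub, Matrix.sub_mul, Matrix.sub_mul, hSS]
    simp
  · rintro (_ | i) ρ hρ
    · exact hρ.elim
    · have h1 := hself i ρ hρ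
      have h2 := congrArg conjTranspose h1
      rw [conjTranspose_mul, hP, (hd i ρ hρ).1.1.eq] at h2
      change P i * ρ * P i = ρ
      rw [h1, h2]
  · rintro (_ | i) o ho ρ hρ
    · exact hρ.elim
    · rcases o with _ | k
      · change (1 - S) * ρ = 0
        have h1 : S * ρ = ρ := by
          rw [Matrix.sum_mul, Finset.sum_eq_single i]
          · exact hself i ρ hρ
          · exact fun j _ hj => hzero j i (fun h => hj (Subtype.ext h)) ρ hρ
          · simp
        rw [Matrix.sub_mul, h1, Matrix.one_mul, sub_self]
      · exact hzero k i (fun h => ho (congrArg some (Subtype.ext h))) ρ hρ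
  · rintro (_ | i)
    · exact isPurifiable_empty
    · exact isPurifiable_of_isEssentiallyPure (hd i) (hN i)

end Sufficiency

/-! ### From purifying reversible channels to orthogonal unions -/

section Necessity

variable {n : Type*} [Fintype n] [DecidableEq n]

theorem isEssentiallyPure_of_fintype {A B C : Type*} [Fintype A] [Fintype B] [Fintype C]
    [DecidableEq A] [DecidableEq B] [DecidableEq C] {S : Set (Matrix n n ℂ)}
    (ω : Matrix C C ℂ) (σ : Matrix B B ℂ) (U : Matrix (n × C) (A × B) ℂ)
    (hω : IsDensity ω) (hσ : IsDensity σ) (hU : U * Uᴴ = 1) (hU' : Uᴴ * U = 1)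
    (hS : ∀ ρ ∈ S, ∃ φ : A → ℂ, ρ ⊗ₖ ω = U * (vecMulVec φ (star φ) ⊗ₖ σ) * Uᴴ) :
    IsEssentiallyPure S := by
  let eA := Fintype.equivFin A
  let eB := Fintype.equivFin B
  let eC := Fintype.equivFin C
  let f := ((Equiv.refl n).prodCongr eC).symm
  let g := (eA.prodCongr eB).symm
  refine ⟨_, _, _, ω.submatrix eC.symm eC.symm, σ.submatrix eB.symm eB.symm, U.submatrix f g,
    ⟨hω.1.submatrix _, ?_⟩, ⟨hσ.1.submatrix _, ?_⟩, ?_, ?_, ?_⟩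
  · rw [← hω.2, Matrix.trace, Matrix.trace, ← eC.symm.sum_comp]
    rfl
  · rw [← hσ.2, Matrix.trace, Matrix.trace, ← eB.symm.sum_comp]
    rfl
  · rw [conjTranspose_submatrix, submatrix_mul_equiv, hU, submatrix_one_equiv]
  · rw [conjTranspose_submatrix, submatrix_mul_equiv, hU', submatrix_one_equiv]
  · rintro _ ⟨ρ, hρ, rfl⟩
    obtain ⟨φ, hφ⟩ := hS ρ hρ
    refine ⟨φ ∘ eA.symm, ?_⟩
    have h1 : vecMulVec (φ ∘ eA.symm) (star (φ ∘ eA.symm)) ⊗ₖ σ.submatrix eB.symm eB.symm =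
        (vecMulVec φ (star φ) ⊗ₖ σ).submatrix g g := rfl
    have h2 : ρ ⊗ₖ ω.submatrix eC.symm eC.symm = (ρ ⊗ₖ ω).submatrix f f := rfl
    dsimp only
    rw [h1, h2, hφ, conjTranspose_submatrix, submatrix_mul_equiv, submatrix_mul_equiv]

/-- Mixtures of isometries with orthogonal ranges produce essentially pure sets. -/
theorem isEssentiallyPure_of_orthogonal_kraus {A κ : Type*} [Fintype A] [DecidableEq A]
    [Nonempty A] [Nonempty n] [Fintype κ] [DecidableEq κ] {S : Set (Matrix n n ℂ)}
    (T : κ → Matrix n A ℂ) (p : κ → ℝ) (hp : ∀ j, 0 ≤ p j) (hsum : ∑ j, p j = 1)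
    (hT : ∀ j k, (T j)ᴴ * T k = diagonal (fun j => (p j : ℂ)) j k • (1 : Matrix A A ℂ))
    (hS : ∀ ρ ∈ S, ∃ φ : A → ℂ, ρ = ∑ j, vecMulVec (T j *ᵥ φ) (star (T j *ᵥ φ))) :
    IsEssentiallyPure S := by
  obtain ⟨j₀⟩ : Nonempty κ := by
    by_contra h
    rw [not_nonempty_iff] at h
    simp at hsum
  obtain ⟨i₀⟩ := ‹Nonempty n›
  obtain ⟨x₀⟩ := ‹Nonempty A›
  let c₀ : A × κ := (x₀, j₀)
  -- The columns of T_j / √p_j, tensored with a fixed ancilla vector. Taking H_B = n ⊗ κ and H_C = A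
  -- ⊗ κ makes both sides of U have the same dimension.
  let v : A × (n × κ) → EuclideanSpace ℂ (n × (A × κ)) := fun q =>
    WithLp.toLp 2 fun r => if r.2 = c₀ then ((Real.sqrt (p q.2.2) : ℂ))⁻¹ * T q.2.2 r.1 q.1 else 0
  let s : Set (A × (n × κ)) := {q | q.2.1 = i₀ ∧ p q.2.2 ≠ 0}
  have hsq : ∀ j, (Real.sqrt (p j) : ℂ) * Real.sqrt (p j) = p j := fun j => by
    rw [← Complex.ofReal_mul, Real.mul_self_sqrt (hp j)]
  have hv : Orthonormal ℂ (s.domRestrict v) := by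
    rw [orthonormal_iff_ite]
    rintro ⟨⟨x, i, j⟩, hi, hj⟩ ⟨⟨y, i', k⟩, hi', hk⟩
    simp only at hi hj hi' hk
    subst hi hi'
    have h1 : inner ℂ (v (x, i', j)) (v (y, i', k)) =
        ((Real.sqrt (p j) : ℂ))⁻¹ * ((Real.sqrt (p k) : ℂ))⁻¹ * ((T j)ᴴ * T k) x y := by
      rw [EuclideanSpace.inner_eq_star_dotProduct]
      simp only [v, dotProduct, Fintype.sum_prod_type (α₁ := n), Pi.star_apply, apply_ite star,
        star_zero, mul_ite, mul_zero, ite_mul, zero_mul, Finset.sum_ite_eq', Finset.mem_univ,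
        if_true, Matrix.mul_apply, Finset.mul_sum, conjTranspose_apply]
      refine Finset.sum_congr rfl fun i _ => ?_
      simp
      ring
    change inner ℂ (v (x, i', j)) (v (y, i', k)) = _
    rw [h1, hT]
    by_cases hjk : j = k
    · subst hjk
      by_cases hxy : x = y
      · subst hxy
        have hne : (p j : ℂ) ≠ 0 := by exact_mod_cast hj
        simp only [diagonal_apply_eq, Matrix.smul_apply, one_apply_eq, smul_eq_mul, mul_one,
          if_true]
        rw [← mul_inv, hsq, inv_mul_cancel₀ hne]
      · simp [hxy]
    · simp [hjk]
  -- U is any unitary extending the partial isometry given by `v` on `s`.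
  obtain ⟨b, hb⟩ := hv.exists_orthonormalBasis_extension_of_card_eq
    (by simp only [finrank_euclideanSpace, Fintype.card_prod]; ring)
  let U : Matrix (n × (A × κ)) (A × (n × κ)) ℂ := Matrix.of fun r q => b q r
  have hUU : Uᴴ * U = 1 := by
    ext q q'
    have := orthonormal_iff_ite.1 b.orthonormal q q'
    rw [EuclideanSpace.inner_eq_star_dotProduct, dotProduct_comm] at this
    rw [Matrix.one_apply, ← this]
    rfl
  have hUU' : U * Uᴴ = 1 := (mul_eq_one_comm_of_card_eq _ _ _ (by
    simp only [Fintype.card_prod]; ring)).1 hUU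
  -- The factor √p_j lets the identity cover p_j = 0, where T_j vanishes.
  have hkey : ∀ x j r, (Real.sqrt (p j) : ℂ) * U r (x, (i₀, j)) =
      if r.2 = c₀ then T j r.1 x else 0 := by
    intro x j r
    by_cases hj : p j = 0
    · have h0 : T j = 0 := by
        rw [← conjTranspose_mul_self_eq_zero, hT]
        simp [hj]
      simp [hj, h0]
    · have h1 : U r (x, (i₀, j)) = v (x, (i₀, j)) r := by
        rw [← hb (x, (i₀, j)) ⟨rfl, hj⟩]
        rfl
      have h2 : (Real.sqrt (p j) : ℂ) ≠ 0 := by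
        exact_mod_cast (Real.sqrt_pos.2 (lt_of_le_of_ne (hp j) (Ne.symm hj))).ne'
      rw [h1]
      simp only [v, mul_ite, mul_zero]
      rw [mul_inv_cancel_left₀ h2]
  refine isEssentiallyPure_of_fintype (diagonal (Pi.single c₀ 1))
    (diagonal fun q : n × κ => if q.1 = i₀ then (p q.2 : ℂ) else 0) U ⟨?_, ?_⟩ ⟨?_, ?_⟩ hUU' hUU ?_
  · exact PosSemidef.diagonal (Pi.single_nonneg.2 zero_le_one)
  · rw [trace_diagonal, Finset.sum_pi_single']
    simp
  · refine PosSemidef.diagonal fun q => ?_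
    change (0 : ℂ) ≤ if q.1 = i₀ then (p q.2 : ℂ) else 0
    split_ifs
    · exact_mod_cast hp q.2
    · exact le_rfl
  · rw [trace_diagonal, Fintype.sum_prod_type]
    rw [Finset.sum_eq_single i₀]
    · simpa using (by exact_mod_cast hsum : ∑ j, (p j : ℂ) = 1)
    · intro i _ hi
      simp [hi]
    · simp
  · intro ρ hρ
    obtain ⟨φ, hφ⟩ := hS ρ hρ
    refine ⟨φ, ?_⟩
    -- The terms √p_j φ ⊗ (i₀, j) of φφ† ⊗ σ; U maps the j-th one to T_j φ ⊗ c₀.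
    let g : κ → A × (n × κ) → ℂ := fun j q =>
      if q.2 = (i₀, j) then (Real.sqrt (p j) : ℂ) * φ q.1 else 0
    have h1 : vecMulVec φ (star φ) ⊗ₖ
        diagonal (fun q : n × κ => if q.1 = i₀ then (p q.2 : ℂ) else 0) =
        ∑ j, vecMulVec (g j) (star (g j)) := by
      ext ⟨x, i, j⟩ ⟨y, i', k⟩
      simp only [kroneckerMap_apply, vecMulVec_apply, Matrix.sum_apply, g, Pi.star_apply,
        Prod.mk.injEq, diagonal_apply]
      rw [Finset.sum_eq_single j]
      · by_cases hi : i = i₀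
        · by_cases hi' : i' = i₀
          · by_cases hjk : j = k
            · subst hi hi' hjk
              simp only [and_self, if_true, star_mul', ← hsq j]
              simp
              ring
            · simp [hi, hi', hjk, Ne.symm hjk]
          · simp [hi, hi', Ne.symm hi']
        · simp [hi]
      · intro l _ hl
        simp [hl.symm]
      · simp
    have h2 : ∀ j, U *ᵥ g j = fun r => if r.2 = c₀ then (T j *ᵥ φ) r.1 else 0 := by
      intro j
      ext r
      simp only [Matrix.mulVec, dotProduct, g, mul_ite, mul_zero, Fintype.sum_prod_type (α₁ := A),
        Finset.sum_ite_eq', Finset.mem_univ, if_true]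
      have h3 : ∀ x, U r (x, (i₀, j)) * ((Real.sqrt (p j) : ℂ) * φ x) =
          (if r.2 = c₀ then T j r.1 x else 0) * φ x := fun x => by
        rw [← hkey x j r]
        ring
      simp_rw [h3]
      split_ifs <;> simp
    rw [h1, Matrix.mul_sum, Matrix.sum_mul]
    simp_rw [conj_vecMulVec, h2]
    ext ⟨i, c⟩ ⟨i', c'⟩
    simp only [kroneckerMap_apply, hφ, Matrix.sum_apply, vecMulVec_apply, Pi.star_apply,
      diagonal_apply]
    by_cases hc : c = c₀
    · by_cases hc' : c' = c₀
      · simp [hc, hc']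
      · simp [hc, hc', Ne.symm hc']
    · by_cases hc' : c = c'
      · simp [hc, ← hc']
      · simp [hc, hc']

/-- A code satisfying the Knill–Laflamme conditions produces essentially pure sets. -/
theorem isEssentiallyPure_of_knill_laflamme {A κ : Type*} [Fintype A] [DecidableEq A]
    [Nonempty A] [Nonempty n] [Fintype κ] [DecidableEq κ] {S : Set (Matrix n n ℂ)}
    (T : κ → Matrix n A ℂ) (α : Matrix κ κ ℂ) (hα : IsDensity α)
    (hT : ∀ j k, (T j)ᴴ * T k = α j k • (1 : Matrix A A ℂ))
    (hS : ∀ ρ ∈ S, ∃ φ : A → ℂ, ρ = ∑ j, vecMulVec (T j *ᵥ φ) (star (T j *ᵥ φ))) :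
    IsEssentiallyPure S := by
  obtain ⟨W, d, hd, hW, hW', h⟩ := exists_unitary_diagonal hα.1
  have hdiag : Wᴴ * α * W = diagonal (fun i => (d i : ℂ)) := by
    rw [h, show Wᴴ * (W * diagonal (fun i => (d i : ℂ)) * Wᴴ) * W =
      (Wᴴ * W) * diagonal (fun i => (d i : ℂ)) * (Wᴴ * W) by simp only [Matrix.mul_assoc], hW,
      Matrix.one_mul, Matrix.mul_one]
  refine isEssentiallyPure_of_orthogonal_kraus (fun j => ∑ k, W k j • T k) d hd ?_ ?_ ?_
  · have := hα.2
    rw [h, trace_mul_cycle, hW, Matrix.one_mul, trace_diagonal] at this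
    exact_mod_cast this
  · intro j k
    rw [← hdiag, conjTranspose_sum, Matrix.sum_mul]
    simp_rw [Matrix.mul_sum, conjTranspose_smul, Matrix.smul_mul, Matrix.mul_smul, hT, smul_smul,
      ← Finset.sum_smul]
    congr 1
    simp only [Matrix.mul_apply, Finset.sum_mul, conjTranspose_apply]
    rw [Finset.sum_comm]
    refine Finset.sum_congr rfl fun l _ => Finset.sum_congr rfl fun l' _ => ?_
    ring
  · intro ρ hρ
    obtain ⟨φ, hφ⟩ := hS ρ hρ
    refine ⟨φ, ?_⟩
    -- The sum is GG† with columns u_j, unchanged when G is multiplied on the right by a unitary.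
    have hG : ∀ u : κ → n → ℂ, ∑ j, vecMulVec (u j) (star (u j)) =
        (Matrix.of fun i j => u j i) * (Matrix.of fun i j => u j i)ᴴ := fun u => by
      ext i i'
      simp [Matrix.sum_apply, vecMulVec_apply, Matrix.mul_apply]
    have hGW : (Matrix.of fun i j => ((∑ k, W k j • T k) *ᵥ φ) i) =
        (Matrix.of fun i j => (T j *ᵥ φ) i) * W := by
      ext i j
      simp [Matrix.sum_mulVec, Matrix.smul_mulVec, Matrix.mul_apply, mul_comm]
    rw [hφ, hG, hG, hGW, conjTranspose_mul, Matrix.mul_assoc, ← Matrix.mul_assoc W, hW',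
      Matrix.one_mul]

theorem dotProduct_eq_sum_kraus {m κ : Type*} [Fintype m] [Fintype κ]
    {K : κ → Matrix m n ℂ}
    (hK : ∑ l, (K l)ᴴ * K l = 1) (x y : n → ℂ) :
    ∑ l, star (K l *ᵥ x) ⬝ᵥ (K l *ᵥ y) = star x ⬝ᵥ y := by
  conv_rhs => rw [← Matrix.one_mulVec y, ← hK, Matrix.sum_mulVec, dotProduct_sum]
  refine Finset.sum_congr rfl fun l _ => ?_
  rw [star_mulVec, ← dotProduct_mulVec, mulVec_mulVec]

/-- Each term of a decomposition of a pure state is proportional to it. -/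
theorem eq_smul_of_sum_vecMulVec_eq {κ : Type*} [Fintype κ] {v : κ → n → ℂ} {ψ : n → ℂ}
    (hψ : star ψ ⬝ᵥ ψ = 1)
    (h : ∑ l, vecMulVec (v l) (star (v l)) = vecMulVec ψ (star ψ)) (l : κ) :
    v l = (star ψ ⬝ᵥ v l) • ψ := by
  let P : Matrix n n ℂ := 1 - vecMulVec ψ (star ψ)
  -- Compressing the decomposition to the complement of ψ leaves a sum of squared norms equal to
  -- zero.
  have hP : ∀ x, P *ᵥ x = x - (star ψ ⬝ᵥ x) • ψ := fun x => by
    rw [Matrix.sub_mulVec, Matrix.one_mulVec, vecMulVec_mulVec]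
    simp
  have h1 := congrArg (fun X => (P * X * Pᴴ).trace) h
  simp only [Matrix.mul_sum, Matrix.sum_mul, conj_vecMulVec, trace_sum, trace_vecMulVec] at h1
  simp only [hP ψ, hψ, one_smul, sub_self, zero_dotProduct, dotProduct_comm _ (star (P *ᵥ _))] at h1
  have h2 := (Finset.sum_eq_zero_iff_of_nonneg
    (fun j _ => dotProduct_star_self_nonneg (P *ᵥ v j))).1 h1 l (Finset.mem_univ l)
  rw [dotProduct_star_self_eq_zero, hP, sub_eq_zero] at h2
  exact h2

/-- Joint eigenvectors of Kraus operators with different eigenvalues are orthogonal. -/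
theorem dotProduct_eq_zero_of_joint_eigenvectors {κ : Type*} [Fintype κ] {K : κ → Matrix n n ℂ}
    (hK : ∑ l, (K l)ᴴ * K l = 1) {x y : n → ℂ} (hx : star x ⬝ᵥ x = 1) (hy : star y ⬝ᵥ y = 1)
    {a b : κ → ℂ} (ha : ∀ l, K l *ᵥ x = a l • x) (hb : ∀ l, K l *ᵥ y = b l • y) (hab : a ≠ b) :
    star x ⬝ᵥ y = 0 := by
  by_contra hxy
  -- Gives ⟨c, d⟩⟨u, w⟩ = ⟨u, w⟩. If ⟨x, y⟩ ≠ 0, then a and b are unit vectors with inner product 1,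
  -- so a = b.
  have key : ∀ (u w : n → ℂ) (c d : κ → ℂ), (∀ l, K l *ᵥ u = c l • u) →
      (∀ l, K l *ᵥ w = d l • w) → (star c ⬝ᵥ d) * (star u ⬝ᵥ w) = star u ⬝ᵥ w := by
    intro u w c d hc hd
    conv_rhs => rw [← dotProduct_eq_sum_kraus hK u w]
    rw [dotProduct, Finset.sum_mul]
    refine Finset.sum_congr rfl fun l _ => ?_
    rw [hc, hd, star_smul, smul_dotProduct, dotProduct_smul, smul_eq_mul, smul_eq_mul, mul_assoc]
    rfl
  have haa : star a ⬝ᵥ a = 1 := by simpa [hx] using key x x a a ha ha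
  have hbb : star b ⬝ᵥ b = 1 := by simpa [hy] using key y y b b hb hb
  have hab1 : star a ⬝ᵥ b = 1 := mul_right_cancel₀ hxy ((key x y a b ha hb).trans (one_mul _).symm)
  have hba1 : star b ⬝ᵥ a = 1 := by
    rw [← star_one, ← hab1, ← star_dotProduct_star, star_star, dotProduct_comm]
  apply hab
  rw [← sub_eq_zero, ← dotProduct_star_self_eq_zero, star_sub,
    sub_dotProduct, dotProduct_sub, dotProduct_sub, haa, hbb, hab1, hba1]
  ring

omit [DecidableEq n] in
/-- An orthonormal basis of a joint eigenspace, as the columns of a matrix. -/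
theorem exists_isometry_onto_joint_eigenspace {κ : Type*} (K : κ → Matrix n n ℂ) (c : κ → ℂ) :
    ∃ (a : ℕ) (Q : Matrix n (Fin a) ℂ), Qᴴ * Q = 1 ∧ (∀ l, K l * Q = c l • Q) ∧
      ∀ x, (∀ l, K l *ᵥ x = c l • x) → ∃ φ, x = Q *ᵥ φ := by
  let E : Submodule ℂ (EuclideanSpace ℂ n) :=
    { carrier := {x | ∀ l, K l *ᵥ x.ofLp = c l • x.ofLp}
      add_mem' := fun hx hy l => by
        simp only [WithLp.ofLp_add, Matrix.mulVec_add, hx l, hy l, smul_add]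
      zero_mem' := fun l => by simp
      smul_mem' := fun t x hx l => by
        simp only [WithLp.ofLp_smul, Matrix.mulVec_smul, hx l, smul_comm t] }
  let b := stdOrthonormalBasis ℂ E
  refine ⟨_, Matrix.of fun i x => (b x : EuclideanSpace ℂ n) i, ?_, ?_, ?_⟩
  · ext x y
    have := orthonormal_iff_ite.1 b.orthonormal x y
    rw [Submodule.coe_inner, EuclideanSpace.inner_eq_star_dotProduct, dotProduct_comm] at this
    rw [Matrix.one_apply, ← this]
    rfl
  · intro l
    ext i x
    exact congrFun ((b x).2 l) i
  · intro x hx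
    let x' : E := ⟨WithLp.toLp 2 x, hx⟩
    refine ⟨fun j => b.repr x' j, ?_⟩
    have h1 := congrArg (fun y : E => (y : EuclideanSpace ℂ n)) (b.sum_repr x')
    ext i
    have h2 := congrArg (fun y : EuclideanSpace ℂ n => y i) h1
    simp only [Submodule.coe_sum, Submodule.coe_smul, WithLp.ofLp_sum, Finset.sum_apply,
      WithLp.ofLp_smul, Pi.smul_apply, smul_eq_mul] at h2
    rw [show x i = (x' : EuclideanSpace ℂ n) i from rfl, ← h2]
    exact Finset.sum_congr rfl fun j _ => mul_comm _ _

theorem exists_orthogonal_union_of_isPurifiable {M : Set (Matrix n n ℂ)}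
    (hM : ∀ ρ ∈ M, IsDensity ρ) (h : IsPurifiable M) :
    ∃ (ι : Type) (N : ι → Set (Matrix n n ℂ)), M = ⋃ i, N i ∧
      (∀ i j, i ≠ j → Orthogonal (N i) (N j)) ∧ ∀ i, IsEssentiallyPure (N i) := by
  obtain ⟨m, Φ, hΦ, hpur, Φ', hΦ', hrev⟩ := h
  obtain ⟨p, S, hS⟩ := IsCP.exists_kraus hΦ.1
  obtain ⟨q, R, hR⟩ := IsCP.exists_kraus hΦ'.1
  have hS1 := sum_conjTranspose_mul_self_eq_one hS hΦ.2
  have hR1 := sum_conjTranspose_mul_self_eq_one hR hΦ'.2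
  let K : Fin p × Fin q → Matrix (Fin m) (Fin m) ℂ := fun l => S l.1 * R l.2
  have hmid : ∀ {a b : Type} (X : Matrix n a ℂ) (Y : Matrix n b ℂ),
      Xᴴ * Y = ∑ i, (S i * X)ᴴ * (S i * Y) := fun X Y => by
    conv_lhs => rw [← Matrix.one_mul Y, ← hS1, Matrix.sum_mul, Matrix.mul_sum]
    refine Finset.sum_congr rfl fun i _ => ?_
    rw [conjTranspose_mul]
    simp only [Matrix.mul_assoc]
  have hK1 : ∑ l, (K l)ᴴ * K l = 1 := by
    rw [Fintype.sum_prod_type_right, ← hR1]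
    exact Finset.sum_congr rfl fun j _ => (hmid (R j) (R j)).symm
  let N : (Fin p × Fin q → ℂ) → Set (Matrix n n ℂ) := fun c => {ρ ∈ M | ∃ ψ : Fin m → ℂ,
    star ψ ⬝ᵥ ψ = 1 ∧ Φ ρ = vecMulVec ψ (star ψ) ∧ ∀ l, K l *ᵥ ψ = c l • ψ}
  have hdec : ∀ ρ ∈ M, ∀ ψ : Fin m → ℂ, Φ ρ = vecMulVec ψ (star ψ) →
      ρ = ∑ j, vecMulVec (R j *ᵥ ψ) (star (R j *ᵥ ψ)) := fun ρ hρ ψ hψ => by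
    rw [← hrev ρ hρ, hψ, hR]
    simp_rw [conj_vecMulVec]
  have hpsd : ∀ ρ ∈ M, (Φ ρ).PosSemidef := fun ρ hρ => by
    rw [hS]
    exact posSemidef_sum _ fun i _ => (hM ρ hρ).1.mul_mul_conjTranspose_same _
  -- A state in each piece guarantees that the space and the joint eigenspace are nonzero.
  refine ⟨{c // (N c).Nonempty}, fun c => N c, ?_, ?_, ?_⟩
  · ext ρ
    rw [Set.mem_iUnion]
    refine ⟨fun hρ => ?_, fun ⟨_, h⟩ => h.1⟩
    obtain ⟨ψ, hψ, hΦψ⟩ := exists_eq_vecMulVec (hpsd ρ hρ)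
      ((hΦ.2 ρ).trans (hM ρ hρ).2) (hpur ρ hρ)
    have hfix : ∑ l, vecMulVec (K l *ᵥ ψ) (star (K l *ᵥ ψ)) = vecMulVec ψ (star ψ) := by
      conv_rhs => rw [← hΦψ, ← hrev ρ hρ, hS, hR, hΦψ]
      rw [Fintype.sum_prod_type]
      refine Finset.sum_congr rfl fun i _ => ?_
      rw [Matrix.mul_sum, Matrix.sum_mul]
      refine Finset.sum_congr rfl fun j _ => ?_
      rw [← conj_vecMulVec]
      simp only [K, conjTranspose_mul, Matrix.mul_assoc]
    have hmem : ρ ∈ N fun l => star ψ ⬝ᵥ (K l *ᵥ ψ) :=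
      ⟨hρ, ψ, hψ, hΦψ, eq_smul_of_sum_vecMulVec_eq hψ hfix⟩
    exact ⟨⟨_, ρ, hmem⟩, hmem⟩
  · rintro ⟨c, hc⟩ ⟨d, hd⟩ hcd ρ ⟨hρ, x, hx, hΦx, hcx⟩ σ ⟨hσ, y, hy, hΦy, hdy⟩
    have hxy := dotProduct_eq_zero_of_joint_eigenvectors hK1 hx hy hcx hdy
      fun h => hcd (Subtype.ext h)
    -- Inserting ∑ S_i†S_i = 1 reduces each overlap to multiples of ⟨x, y⟩ = 0.
    have hz : ∀ j k, star (R j *ᵥ x) ⬝ᵥ (R k *ᵥ y) = 0 := fun j k => by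
      rw [← dotProduct_eq_sum_kraus hS1]
      refine Finset.sum_eq_zero fun i _ => ?_
      rw [mulVec_mulVec, mulVec_mulVec, hcx (i, j), hdy (i, k), star_smul, smul_dotProduct,
        dotProduct_smul, hxy, smul_zero, smul_zero]
    rw [hdec ρ hρ x hΦx, hdec σ hσ y hΦy, Matrix.sum_mul]
    simp_rw [Matrix.mul_sum, vecMulVec_mul_vecMulVec, hz]
    simp
  · rintro ⟨c, ρ₀, hρ₀, ψ₀, hψ₀, -, hcψ₀⟩
    obtain ⟨a, Q, hQ, hKQ, hQψ⟩ := exists_isometry_onto_joint_eigenspace K c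
    have hn : Nonempty n := by
      by_contra hn
      rw [not_nonempty_iff] at hn
      have := (hM ρ₀ hρ₀).2
      simp [Matrix.trace] at this
    have hA : Nonempty (Fin a) := by
      by_contra hA
      rw [not_nonempty_iff] at hA
      obtain ⟨φ, hφ⟩ := hQψ ψ₀ hcψ₀
      rw [hφ, Subsingleton.elim φ 0, Matrix.mulVec_zero] at hψ₀
      simp at hψ₀
    -- The eigenvalue tuple as a matrix; L†L is the Knill–Laflamme matrix.
    let L : Matrix (Fin p) (Fin q) ℂ := Matrix.of fun i j => c (i, j)
    have hT : ∀ j k, (R j * Q)ᴴ * (R k * Q) = (Lᴴ * L) j k • (1 : Matrix (Fin a) (Fin a) ℂ) := by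
      intro j k
      rw [hmid, Matrix.mul_apply, Finset.sum_smul]
      refine Finset.sum_congr rfl fun i _ => ?_
      have hKQ' : ∀ j, S i * (R j * Q) = c (i, j) • Q := fun j => by
        rw [← Matrix.mul_assoc]
        exact hKQ (i, j)
      rw [hKQ', hKQ', conjTranspose_smul, Matrix.smul_mul, Matrix.mul_smul, hQ, smul_smul]
      rfl
    refine isEssentiallyPure_of_knill_laflamme (fun j => R j * Q) (Lᴴ * L)
      ⟨posSemidef_conjTranspose_mul_self L, ?_⟩ hT ?_
    · obtain ⟨x⟩ := hA
      have h1 : ∑ j, (R j * Q)ᴴ * (R j * Q) = 1 := by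
        rw [← hQ]
        conv_rhs => rw [← Matrix.mul_one Qᴴ, ← hR1, Matrix.mul_sum, Matrix.sum_mul]
        refine Finset.sum_congr rfl fun i _ => ?_
        rw [conjTranspose_mul]
        simp only [Matrix.mul_assoc]
      simp_rw [hT, ← Finset.sum_smul] at h1
      simpa [Matrix.trace] using congrFun (congrFun h1 x) x
    · rintro ρ ⟨hρ, ψ, -, hΦψ, hcψ⟩
      obtain ⟨φ, rfl⟩ := hQψ ψ hcψ
      refine ⟨φ, ?_⟩
      simpa only [mulVec_mulVec] using hdec ρ hρ _ hΦψ

end Necessity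

end PurRev

theorem theorem1 {n : Type*} [Fintype n] [DecidableEq n] (M : Set (Matrix n n ℂ))
    (hM : ∀ ρ ∈ M, PurRev.IsDensity ρ) :
    (∃ (m : ℕ) (Φ : Matrix n n ℂ →ₗ[ℂ] Matrix (Fin m) (Fin m) ℂ),
      PurRev.IsCPTP Φ ∧ PurRev.IsPurifyingOn Φ M ∧ PurRev.IsReversibleOn Φ M) ↔
    ∃ (ι : Type) (N : ι → Set (Matrix n n ℂ)),
      M = ⋃ i, N i ∧
      (∀ i j, i ≠ j → PurRev.Orthogonal (N i) (N j)) ∧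
      ∀ i, PurRev.IsEssentiallyPure (N i) :=
  ⟨PurRev.exists_orthogonal_union_of_isPurifiable hM, fun ⟨_, N, hMN, horth, hN⟩ =>
    PurRev.isPurifiable_of_orthogonal_union hM N hMN horth hN⟩
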